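/- Write $\Delta(P,Q)=\frac12\sum_a|P(a)-Q(a)|$ for the total variation distance. A quantum circuit on $n$ qubits is a sequence of layers, each consisting of one-qubit unitary gates (arbitrary ones are allowed) and two-qubit CNOT gates acting on pairwise disjoint sets of qubits; its depth is the number of layers, and its $n$-bit output distribution is obtained by applying it to $|0^n\rangle$ and measuring all $n$ qubits in the computational basis. A family $\{C_n\}$ of such circuits is uniform if a description of $C_n$ can be found in polynomial time: a Turing machine, given $1^n$ and $1^k$, outputs in time polynomial in $n+k$ the list of the gates of $C_n$, layer by layer, with the entries of all one-qubit gates given as Gaussian rationals up to error $2^{-k}$. A classical circuit has fan-in 2 if each of its gates is a Boolean function of at most two wires (its fan-out and size are not restricted). There exists a uniform family of constant-depth quantum circuits $\{C_n\}_{n\in\mathbb N}$, with $C_n$ acting on $n$ qubits, such that for each $\delta\in[0,1)$ the following holds. Any classical circuit with fan-in 2 which takes $n+n^\delta$ uniformly random bits as input and samples from the $n$-bit output distribution of $C_n$ to within total variation distance $\frac13-\omega(1/\log n)$ has depth $\Omega(\log\log n)$. Explicitly: for each $\delta\in[0,1)$ there is a constant $c>0$ such that for every function $g:\mathbb N\to\mathbb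 R$ with $g(n)\log n\to\infty$ and all sufficiently large $n$ (depending on $\delta$ and $g$), every fan-in-2 classical circuit that takes at most $n+\lceil n^\delta\rceil$ uniformly random input bits, and whose output distribution is within total variation distance $\frac13-g(n)$ of the output distribution of $C_n$, has depth at least $c\log\log n$. -/

import Mathlib

open Filter

/-! ### Total variation distance -/

/-- Total variation distance of two distributions on a finite set, given by their mass functions:
half of the `ℓ¹` distance. -/
noncomputable def tvDist {α : Type*} [Fintype α] (P Q : α → ℝ) : ℝ :=
  (1 / 2) * ∑ a, |P a - Q a|

/-! ### Classical circuits of fan-in two -/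

/-- A wire of a Boolean circuit with `ℓ` input bits and `s` gates: an input bit or the output of
one of the gates.  A wire may be read any number of times (fan-out is unbounded). -/
inductive Wire (ℓ s : ℕ) : Type
  | input (i : Fin ℓ)
  | gate (j : Fin s)

/-- A gate that may read the inputs and `s` earlier gates: a constant, or an arbitrary Boolean
function of two wires. -/
inductive BoolGate (ℓ s : ℕ) : Type
  | const (b : Bool)
  | op (φ : Bool → Bool → Bool) (u v : Wire ℓ s)

/-- A sequence of `s` gates, each reading inputs and earlier gates only (a directed acyclic graph
in topological order). -/
inductive GateList (ℓ : ℕ) : ℕ → Type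
  | nil : GateList ℓ 0
  | snoc {s : ℕ} (L : GateList ℓ s) (g : BoolGate ℓ s) : GateList ℓ (s + 1)

/-- The bit on a wire, for input `x` and gate values `v`. -/
def Wire.value {ℓ s : ℕ} (x : Fin ℓ → Bool) (v : Fin s → Bool) : Wire ℓ s → Bool
  | .input i => x i
  | .gate j => v j

/-- The depth of a wire, for gate depths `d`; input bits have depth `0`. -/
def Wire.depth {ℓ s : ℕ} (d : Fin s → ℕ) : Wire ℓ s → ℕ
  | .input _ => 0
  | .gate j => d j

def BoolGate.value {ℓ s : ℕ} (x : Fin ℓ → Bool) (v : Fin s → Bool) : BoolGate ℓ s → Bool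
  | .const b => b
  | .op φ u w => φ (u.value x v) (w.value x v)

/-- Constants have depth `0`. -/
def BoolGate.depth {ℓ s : ℕ} (d : Fin s → ℕ) : BoolGate ℓ s → ℕ
  | .const _ => 0
  | .op _ u w => max (u.depth d) (w.depth d) + 1

def GateList.values {ℓ : ℕ} (x : Fin ℓ → Bool) : {s : ℕ} → GateList ℓ s → Fin s → Bool
  | _, .nil => Fin.elim0
  | _, .snoc L g => Fin.snoc (α := fun _ => Bool) (L.values x) (g.value x (L.values x))

def GateList.depths {ℓ : ℕ} : {s : ℕ} → GateList ℓ s → Fin s → ℕ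
  | _, .nil => Fin.elim0
  | _, .snoc L g => Fin.snoc (α := fun _ => ℕ) L.depths (g.depth L.depths)

/-- A classical circuit of fan-in two with `ℓ` input bits and `n` output bits. -/
structure BoolCircuit (ℓ n : ℕ) where
  size : ℕ
  gates : GateList ℓ size
  out : Fin n → Wire ℓ size

/-- The function computed by a circuit. -/
def BoolCircuit.eval {ℓ n : ℕ} (K : BoolCircuit ℓ n) (x : Fin ℓ → Bool) : Fin n → Bool :=
  fun i => (K.out i).value x (K.gates.values x)

/-- The depth of a circuit: the largest number of gates on a path that ends in an output. -/
def BoolCircuit.depth {ℓ n : ℕ} (K : BoolCircuit ℓ n) : ℕ :=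
  Finset.univ.sup fun i => (K.out i).depth K.gates.depths

/-- The output distribution of a circuit whose `ℓ` input bits are independent and uniform. -/
noncomputable def BoolCircuit.outputDist {ℓ n : ℕ} (K : BoolCircuit ℓ n) (y : Fin n → Bool) : ℝ :=
  ((Finset.univ.filter fun x : Fin ℓ → Bool => K.eval x = y).card : ℝ) / 2 ^ ℓ

/-! ### Quantum circuits on `n` qubits -/

/-- Elementary gates on `n` qubits: arbitrary one-qubit unitaries and CNOT gates.  The basis states
of a qubit are indexed by `Bool`, with `false` for `|0⟩` and `true` for `|1⟩`. -/
inductive QGate (n : ℕ) : Type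
  | single (i : Fin n) (U : Matrix.unitaryGroup Bool ℂ)
  | cnot (c t : Fin n) (h : c ≠ t)

/-- The qubits a gate acts on. -/
def QGate.support {n : ℕ} : QGate n → Finset (Fin n)
  | .single i _ => {i}
  | .cnot c t _ => {c, t}

/-- The action of a gate on a vector of amplitudes.  (CNOT maps the basis state `x` to the basis
state with `x t` replaced by `x t ⊕ x c`; this permutation is its own inverse.) -/
noncomputable def QGate.apply {n : ℕ} (ψ : (Fin n → Bool) → ℂ) : QGate n → (Fin n → Bool) → ℂ
  | .single i U => fun x => ∑ b : Bool, (U : Matrix Bool Bool ℂ) (x i) b * ψ (Function.update x i b)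
  | .cnot c t _ => fun x => ψ (Function.update x t (xor (x t) (x c)))

/-- A quantum circuit on `n` qubits: a list of layers, each consisting of gates that act on
pairwise disjoint sets of qubits.  The first layer in the list is applied first. -/
structure QuantumCircuit (n : ℕ) where
  layers : List (List (QGate n))
  disjoint : ∀ L ∈ layers, L.Pairwise fun g h => Disjoint g.support h.support

/-- The depth of a quantum circuit is its number of layers. -/
def QuantumCircuit.depth {n : ℕ} (C : QuantumCircuit n) : ℕ :=
  C.layers.length

/-- The state that the circuit produces from the all-zeros state. -/
noncomputable def QuantumCircuit.state {n : ℕ} (C : QuantumCircuit n) : (Fin n → Bool) → ℂ :=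
  C.layers.foldl (fun ψ L => L.foldl QGate.apply ψ) fun x => if x = fun _ => false then 1 else 0

/-- The distribution of the `n` bits obtained by applying the circuit to the all-zeros state and
measuring every qubit in the computational basis. -/
noncomputable def QuantumCircuit.outputDist {n : ℕ} (C : QuantumCircuit n) (y : Fin n → Bool) : ℝ :=
  ‖C.state y‖ ^ 2

/-! ### Uniform families of quantum circuits -/

/-- Finite description of a gate.  A one-qubit gate is described by its qubit and by a matrix of
Gaussian rationals with a common denominator, that is, the matrix with `(a, b)` entry
`((entry a b).1 + (entry a b).2 * I) / den`. -/
inductive GateCode : Type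
  | single (i : ℕ) (entry : Bool → Bool → ℤ × ℤ) (den : ℕ)
  | cnot (c t : ℕ)

/-- The description names the gate `g`, with the matrix entries of one-qubit gates given up to an
error of at most `2⁻ᵏ`. -/
def GateCode.Describes {n : ℕ} (k : ℕ) : GateCode → QGate n → Prop
  | .single i A D, .single i' U => i = i'.val ∧
      ∀ a b, ‖(U : Matrix Bool Bool ℂ) a b
        - (((A a b).1 : ℂ) + ((A a b).2 : ℂ) * Complex.I) / (D : ℂ)‖ ≤ (2 : ℝ)⁻¹ ^ k
  | .cnot c t, .cnot c' t' _ => c = c'.val ∧ t = t'.val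
  | _, _ => False

/-- The finite alphabet in which descriptions are written. -/
inductive CodeSymbol : Type
  | single
  | cnot
  | tick
  | bit (b : Bool)
  | minus
  | comma
  | endLayer
  deriving DecidableEq, Fintype

/-- Qubit labels are written in unary. -/
def writeLabel (i : ℕ) : List CodeSymbol :=
  List.replicate i .tick ++ [.comma]

/-- Natural numbers are written in binary, least significant bit first. -/
def writeNat (m : ℕ) : List CodeSymbol :=
  (Computability.encodeNat m).map .bit ++ [.comma]

def writeInt (z : ℤ) : List CodeSymbol :=
  if z < 0 then .minus :: writeNat z.natAbs else writeNat z.natAbs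

def writeGaussian (z : ℤ × ℤ) : List CodeSymbol :=
  writeInt z.1 ++ writeInt z.2

def GateCode.write : GateCode → List CodeSymbol
  | .single i A D => .single :: (writeLabel i ++ writeGaussian (A false false) ++
      writeGaussian (A false true) ++ writeGaussian (A true false) ++
      writeGaussian (A true true) ++ writeNat D)
  | .cnot c t => .cnot :: (writeLabel c ++ writeLabel t)

/-- The text of a circuit description, layer by layer. -/
def writeCircuit (D : List (List GateCode)) : List CodeSymbol :=
  D.flatMap fun L => L.flatMap GateCode.write ++ [.endLayer]

/-- A family of quantum circuits is uniform if a description of the circuits can be found in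
polynomial time: some Turing machine, given `n` and a precision `k` in unary, writes down in time
polynomial in `n + k` a description of the `n`-th circuit, in which the positions of all gates are
exact and the matrix entries of the one-qubit gates are given up to `2⁻ᵏ`. -/
def IsUniformFamily (C : (n : ℕ) → QuantumCircuit n) : Prop :=
  ∃ D : ℕ × ℕ → List (List GateCode),
    (∀ n k : ℕ, List.Forall₂ (List.Forall₂ (GateCode.Describes k)) (D (n, k)) (C n).layers) ∧
    Nonempty (Turing.TM2ComputableInPolyTime
      (Computability.encodingProd Computability.unaryEncodingNat
        Computability.unaryEncodingNat).encode
      writeCircuit D)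

/-! The quantum circuit is a single layer of rotations with rational entries, so its output bits are
i.i.d. with bias 16/25. A classical circuit of depth t makes each output bit a function of at most d
= 2^t uniform bits, hence of a bias that is a multiple of 2^(-d). Since 5 does not divide 16·2^d,
each such bias misses 16/25 by at least η = 1/(25·2^d) (`le_abs_trueProb_sub`).

If many outputs, indexed by I, read disjoint inputs, these errors accumulate: the Bhattacharyya
coefficient of the two product distributions is at most exp(-|I|η²/4). In general outputs share
inputs, but fixing a set T of popular inputs makes the outputs in I independent. The sampled
distribution on I is then a uniform mixture of 2^|T| product distributions, and by subadditivity of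
the square root its overlap with the target is at most √(2^|T|)·exp(-|I|η²/4)
(`one_sub_tvDist_valueDist_le`).

It remains to find T much smaller than |I|/4^d. `exists_pairwiseDisjoint_sdiff` does so by
pigeonhole over 2d geometric scales of input degree: at some scale at most half of the outputs read
an input of that degree, and the gap between the popular and the remaining inputs gives |T|/|I| of
order d²/R for a ratio R of choice. With R = 10000·d²·4^d the overlap is at most 1/e < 2/3 as soon
as n ≥ 2·R^(2d) (`third_lt_tvDist_valueDist`), which holds when t < (1/4)·log log n and n is large.

Uniformity is shown by an explicit stack machine; the gate entries are exact rationals, so one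
description serves every precision. -/

/-! ### The circuits: one layer of rotations -/

/-- The numerators of the rotation `(1/5) [[3, -4], [4, 3]]`. -/
def rotationEntry : Bool → Bool → ℤ × ℤ
  | false, false => (3, 0)
  | false, true => (-4, 0)
  | true, false => (4, 0)
  | true, true => (3, 0)

/-- The one-qubit rotation `(1/5) [[3, -4], [4, 3]]`. -/
noncomputable def rotationGate : Matrix.unitaryGroup Bool ℂ :=
  ⟨Matrix.of fun a b => ((rotationEntry a b).1 : ℂ) / 5, by
    rw [Matrix.mem_unitaryGroup_iff]
    ext a b
    cases a <;> cases b <;>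
      simp [Matrix.mul_apply, Matrix.star_apply, rotationEntry] <;> norm_num⟩

theorem rotationGate_apply (a b : Bool) :
    (rotationGate : Matrix Bool Bool ℂ) a b = ((rotationEntry a b).1 : ℂ) / 5 := rfl

/-- The circuit that rotates every qubit once.  Its output bits are independent and `true` with
probability `16/25`, which is not a dyadic rational. -/
noncomputable def coinCircuit (n : ℕ) : QuantumCircuit n where
  layers := [(List.finRange n).map fun i => .single i rotationGate]
  disjoint := by
    intro L hL
    rw [List.mem_singleton] at hL
    subst hL
    rw [List.pairwise_map]
    refine (List.nodup_finRange n).imp fun h => ?_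
    simpa [QGate.support] using h

/-- One-qubit gates preserve product states, so the state can be tracked factor by factor. -/
theorem QGate.apply_single_prod {n : ℕ} (φ : Fin n → Bool → ℂ) (i : Fin n)
    (U : Matrix.unitaryGroup Bool ℂ) :
    QGate.apply (fun x => ∏ j, φ j (x j)) (.single i U) =
      fun x => ∏ j, Function.update φ i
        (fun a => ∑ b, (U : Matrix Bool Bool ℂ) a b * φ i b) j (x j) := by
  funext x
  have hrest : ∀ b, ∏ j ∈ Finset.univ.erase i, φ j (Function.update x i b j) =
      ∏ j ∈ Finset.univ.erase i, φ j (x j) := fun b =>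
    Finset.prod_congr rfl fun j hj => by
      rw [Function.update_of_ne (Finset.ne_of_mem_erase hj)]
  rw [QGate.apply, ← Finset.mul_prod_erase _ _ (Finset.mem_univ i), Function.update_self,
    Finset.sum_mul]
  refine Finset.sum_congr rfl fun b _ => ?_
  rw [← Finset.mul_prod_erase _ _ (Finset.mem_univ i), Function.update_self, hrest, mul_assoc]
  congr 2
  exact Finset.prod_congr rfl fun j hj => by
    rw [Function.update_of_ne (Finset.ne_of_mem_erase hj)]

/-- As the qubits in `l` are distinct, every factor meets `U` at most once, and is still the
original `φ j` when it does. -/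
theorem foldl_apply_single {n : ℕ} (U : Matrix.unitaryGroup Bool ℂ) (l : List (Fin n))
    (hl : l.Nodup) (φ : Fin n → Bool → ℂ) :
    (l.map fun i => QGate.single i U).foldl QGate.apply (fun x => ∏ j, φ j (x j)) =
      fun x => ∏ j, if j ∈ l then ∑ b, (U : Matrix Bool Bool ℂ) (x j) b * φ j b
        else φ j (x j) := by
  induction l generalizing φ with
  | nil => simp
  | cons i l ih =>
    rw [List.nodup_cons] at hl
    rw [List.map_cons, List.foldl_cons, QGate.apply_single_prod, ih hl.2]
    funext x
    refine Finset.prod_congr rfl fun j _ => ?_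
    by_cases hj : j = i
    · subst hj
      simp [hl.1]
    · simp [hj]

/-- The mass function of a bit that is `true` with probability `p`. -/
def bernoulliMass (p : ℝ) (b : Bool) : ℝ := if b then p else 1 - p

theorem coinCircuit_outputDist (n : ℕ) (y : Fin n → Bool) :
    (coinCircuit n).outputDist y = ∏ i, bernoulliMass (16 / 25) (y i) := by
  have h0 : (fun x : Fin n → Bool => if x = fun _ => false then (1 : ℂ) else 0) =
      fun x => ∏ j, (fun (_ : Fin n) (b : Bool) => if b = false then (1 : ℂ) else 0) j (x j) := by
    funext x
    rw [Finset.prod_ite_zero]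
    simp [funext_iff]
  have hs : (coinCircuit n).state = fun x => ∏ j, ((rotationEntry (x j) false).1 : ℂ) / 5 := by
    rw [QuantumCircuit.state, h0]
    simp only [coinCircuit, List.foldl_cons, List.foldl_nil]
    rw [foldl_apply_single _ _ (List.nodup_finRange n)
      (fun _ b => if b = false then (1 : ℂ) else 0)]
    funext x
    simp [rotationGate_apply]
  rw [QuantumCircuit.outputDist, hs, norm_prod, ← Finset.prod_pow]
  refine Finset.prod_congr rfl fun i _ => ?_
  cases y i <;> simp [rotationEntry, bernoulliMass] <;> norm_num

/-! ### Uniformity -/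

/-- The description of the rotation of qubit `i`. -/
def rotationCode (i : ℕ) : GateCode := .single i rotationEntry 5

/-- The part of the text of a rotation that does not depend on the qubit. -/
def rotationText : List CodeSymbol :=
  writeGaussian (rotationEntry false false) ++ writeGaussian (rotationEntry false true) ++
    writeGaussian (rotationEntry true false) ++ writeGaussian (rotationEntry true true) ++
    writeNat 5

theorem rotationCode_write (i : ℕ) :
    (rotationCode i).write =
      .single :: (List.replicate i .tick ++ .comma :: rotationText) := by
  simp [rotationCode, GateCode.write, rotationText, writeLabel]

/-- The entries are rationals with denominator 5, so the error is zero for every `k`. -/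
theorem rotationCode_describes {n : ℕ} (k : ℕ) (i : Fin n) :
    (rotationCode i).Describes k (.single i rotationGate) := by
  refine ⟨rfl, fun a b => ?_⟩
  rw [rotationGate_apply]
  cases a <;> cases b <;> simp [rotationEntry]

/-! ### A stack machine that prints the circuit descriptions -/

namespace CoinWriter

/-- The stacks of the machine. -/
inductive Stack
  | input
  | aux
  | output
  deriving DecidableEq

instance : Fintype Stack :=
  ⟨{.input, .aux, .output}, fun k => by cases k <;> decide⟩

/-- The stack alphabets. -/
def Alphabet : Stack → Type
  | .input => Bool ⊕ Bool
  | .aux => Unit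
  | .output => CodeSymbol

/-- The labels of the program. -/
inductive Label
  | start
  | loop
  | move
  | back
  | drain
  deriving DecidableEq

instance : Fintype Label :=
  ⟨{.start, .loop, .move, .back, .drain}, fun l => by cases l <;> decide⟩

open Turing.TM2 Turing.TM2.Stmt

/-- Push the letters of a list, the last one first. -/
def pushAll (w : List CodeSymbol) (q : Stmt Alphabet Label Bool) : Stmt Alphabet Label Bool :=
  w.foldl (fun q a => .push .output (fun _ => a) q) q

/-- Whether the top of the input stack is a unary digit of the first number. -/
def isFirst : Option (Bool ⊕ Bool) → Bool
  | some (.inl _) => true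
  | _ => false

/-- The program.  The text is written from the end to the beginning, as it is read from the top of
the output stack; the loop writes the gate on qubit `i` when `i` digits of the first number are
left.  The
text `w` is the part of the description of a gate that does not depend on the qubit. -/
def program (w : List CodeSymbol) : Label → Stmt Alphabet Label Bool
  | .start => .push .output (fun _ => CodeSymbol.endLayer) (.goto fun _ => .loop)
  | .loop => .pop .input (fun _ a => isFirst a)
      (.branch id
        (pushAll (.comma :: w) (.goto fun _ => .move))
        (.goto fun _ => .drain))
  | .move => .peek .input (fun _ a => isFirst a)
      (.branch id
        (.pop .input (fun v _ => v) (.push .aux (fun _ => ())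
          (.push .output (fun _ => CodeSymbol.tick) (.goto fun _ => .move))))
        (.goto fun _ => .back))
  | .back => .pop .aux (fun _ a => a.isSome)
      (.branch id
        (.push .input (fun _ => (Sum.inl true : Bool ⊕ Bool)) (.goto fun _ => .back))
        (.push .output (fun _ => CodeSymbol.single) (.goto fun _ => .loop)))
  -- A halting configuration must have all stacks but the output empty and the initial internal
  -- state; the last, failing pop resets that state to `false`.
  | .drain => .pop .input (fun _ a => a.isSome)
      (.branch id (.goto fun _ => .drain) .halt)

/-- The description of a gate on qubit `i` that ends with the text `w`. -/
def gateText (w : List CodeSymbol) (i : ℕ) : List CodeSymbol :=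
  .single :: (List.replicate i .tick ++ .comma :: w)

/-- The machine. -/
def machine (w : List CodeSymbol) : Turing.FinTM2 where
  K := Stack
  k₀ := .input
  k₁ := .output
  Γ := Alphabet
  Λ := Label
  main := .start
  σ := Bool
  initialState := false
  Γk₀Fin := inferInstanceAs (Fintype (Bool ⊕ Bool))
  m := program w

/-- The contents of the stacks. -/
def tapes (a : List (Bool ⊕ Bool)) (b : List Unit) (c : List CodeSymbol) :
    (k : Stack) → List (Alphabet k)
  | .input => a
  | .aux => b
  | .output => c

/-! ### Step-counted runs of the machine -/

theorem update_input (a a' b c) :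
    Function.update (tapes a b c) .input a' = tapes a' b c := by
  funext k; cases k <;> rfl

theorem update_output (a b c c') :
    Function.update (tapes a b c) .output c' = tapes a b c' := by
  funext k; cases k <;> rfl

/-- A configuration of the machine. -/
def config (l : Option Label) (v : Bool) (a : List (Bool ⊕ Bool)) (b : List Unit)
    (c : List CodeSymbol) : Cfg Alphabet Label Bool :=
  ⟨l, v, tapes a b c⟩

/-- The machine gets from one configuration to another in exactly `m` steps. -/
def Runs (w : List CodeSymbol) (m : ℕ) (s t : Cfg Alphabet Label Bool) : Prop :=
  (flip Bind.bind (step (program w)))^[m] (some s) = some t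

theorem Runs.trans {w : List CodeSymbol} {m m' : ℕ} {s t u : Cfg Alphabet Label Bool} (h : Runs w m s t)
    (h' : Runs w m' t u) : Runs w (m' + m) s u := by
  rw [Runs, Function.iterate_add_apply, h, h']

theorem Runs.of_step {w : List CodeSymbol} {s t : Cfg Alphabet Label Bool} (h : step (program w) s = some t) :
    Runs w 1 s t := h

theorem stepAux_pushAll (w : List CodeSymbol) (q : Stmt Alphabet Label Bool) (v : Bool)
    (a : List (Bool ⊕ Bool)) (b : List Unit) (c : List CodeSymbol) :
    stepAux (pushAll w q) v (tapes a b c) = stepAux q v (tapes a b (w ++ c)) := by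
  induction w generalizing q with
  | nil => rfl
  | cons x w ih =>
    refine (ih (.push .output (fun _ => x) q)).trans ?_
    change stepAux q v (Function.update (tapes a b (w ++ c)) .output (x :: (w ++ c))) = _
    rw [update_output]
    rfl

theorem stepAux_pop_inl (q q' : Stmt Alphabet Label Bool) (v : Bool)
    (a : List (Bool ⊕ Bool)) (b : List Unit) (c : List CodeSymbol) :
    stepAux (.pop .input (fun _ a => isFirst a) (.branch id q q')) v
      (tapes (.inl true :: a) b c) = stepAux q true (tapes a b c) := by
  rw [stepAux, stepAux, update_input]
  rfl

/-- Each remaining digit of the first number yields one tick of the unary qubit label; `aux`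
remembers the digits so that `runs_back` can restore them. -/
theorem runs_move (w : List CodeSymbol) (i k : ℕ) (v : Bool) (b : List Unit) (c : List CodeSymbol) :
    Runs w (i + 1)
      (config (some .move) v
        (List.replicate i (.inl true) ++ List.replicate k (.inr true)) b c)
      (config (some .back) false (List.replicate k (.inr true))
        (List.replicate i () ++ b) (List.replicate i .tick ++ c)) := by
  induction i generalizing v b c with
  | zero =>
    refine Runs.of_step ?_
    cases k <;> rfl
  | succ i ih =>
    refine Runs.trans (t := config (some .move) true
      (List.replicate i (.inl true) ++ List.replicate k (.inr true)) (() :: b) (.tick :: c))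
      (Runs.of_step ?_) ?_
    · simp only [config, step, program, stepAux]
      refine congrArg some ?_
      change (⟨_, _, _⟩ : Cfg Alphabet Label Bool) = _
      congr 1
      funext k
      cases k <;> rfl
    · convert ih true (() :: b) (.tick :: c) using 2
      · rw [List.replicate_succ', List.append_assoc]; rfl
      · rw [List.replicate_succ', List.append_assoc]; rfl

theorem runs_back (w : List CodeSymbol) (i : ℕ) (v : Bool) (a : List (Bool ⊕ Bool)) (c : List CodeSymbol) :
    Runs w (i + 1)
      (config (some .back) v a (List.replicate i ()) c)
      (config (some .loop) false (List.replicate i (.inl true) ++ a) [] (.single :: c)) := by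
  induction i generalizing v a with
  | zero =>
    refine Runs.of_step ?_
    refine congrArg some ?_
    change (⟨_, _, _⟩ : Cfg Alphabet Label Bool) = ⟨_, _, _⟩
    congr 1
    funext k
    cases k <;> rfl
  | succ i ih =>
    refine Runs.trans (t := config (some .back) true (.inl true :: a) (List.replicate i ()) c)
      (Runs.of_step ?_) ?_
    · refine congrArg some ?_
      change (⟨_, _, _⟩ : Cfg Alphabet Label Bool) = ⟨_, _, _⟩
      congr 1
      funext k
      cases k <;> rfl
    · convert ih true (.inl true :: a) using 2
      rw [List.replicate_succ', List.append_assoc]; rfl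

theorem runs_drain (w : List CodeSymbol) (v : Bool) (a : List (Bool ⊕ Bool)) (c : List CodeSymbol) :
    Runs w (a.length + 1) (config (some .drain) v a [] c) (config none false [] [] c) := by
  induction a generalizing v with
  | nil =>
    refine Runs.of_step (congrArg some ?_)
    change (⟨_, _, _⟩ : Cfg Alphabet Label Bool) = ⟨_, _, _⟩
    congr 1
    funext k
    cases k <;> rfl
  | cons x a ih =>
    refine Runs.trans (Runs.of_step (congrArg some ?_)) (ih true)
    change (⟨_, _, _⟩ : Cfg Alphabet Label Bool) = ⟨_, _, _⟩
    congr 1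
    funext k
    cases k <;> rfl

/-- The first pop of a round leaves `i` digits, so gates are written in order of decreasing label
and end up increasing, as text is added in front. A round that leaves `i` digits takes 2i + 3 steps,
which sums to the quadratic bound. -/
theorem runs_loop (w : List CodeSymbol) (i k : ℕ) (c : List CodeSymbol) :
    ∃ m ≤ i ^ 2 + 2 * i + k + 2, Runs w m
      (config (some .loop) false
        (List.replicate i (.inl true) ++ List.replicate k (.inr true)) [] c)
      (config none false [] []
        ((List.range i).flatMap (gateText w) ++ c)) := by
  induction i generalizing c with
  | zero =>
    -- The failing test has already consumed one digit of the second number if there is one; for `k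
    -- = 0` the truncated `k - 1` is right too.
    have h1 : Runs w 1 (config (some .loop) false (List.replicate k (.inr true)) [] c)
        (config (some .drain) false (List.replicate (k - 1) (.inr true)) [] c) := by
      refine Runs.of_step (congrArg some ?_)
      cases k
      all_goals
        change (⟨_, _, _⟩ : Cfg Alphabet Label Bool) = ⟨_, _, _⟩
        congr 1
        funext k
        cases k <;> rfl
    refine ⟨_, ?_, h1.trans (runs_drain w _ _ _)⟩
    rw [List.length_replicate]
    omega
  | succ i ih =>
    obtain ⟨m, hm, h⟩ := ih (gateText w i ++ c)
    have h1 : Runs w 1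
        (config (some .loop) false
          (List.replicate (i + 1) (.inl true) ++ List.replicate k (.inr true)) [] c)
        (config (some .move) true
          (List.replicate i (.inl true) ++ List.replicate k (.inr true)) []
          (.comma :: w ++ c)) := by
      refine Runs.of_step (congrArg some ?_)
      exact (stepAux_pop_inl _ _ _ (List.replicate i _ ++ _) [] c).trans
        (stepAux_pushAll (.comma :: w) _ true _ _ c)
    have h2 := h1.trans (runs_move w i k true [] (.comma :: w ++ c))
    rw [List.append_nil] at h2
    have h3 := h2.trans (runs_back w i false _ _)
    have h4 : List.flatMap (gateText w) (List.range (i + 1)) ++ c =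
        List.flatMap (gateText w) (List.range i) ++
          (gateText w i ++ c) := by
      rw [List.range_succ, List.flatMap_append, List.append_assoc, List.flatMap_singleton]
    refine ⟨m + (i + 1 + (i + 1 + 1)), by nlinarith, ?_⟩
    rw [h4]
    refine h3.trans ?_
    convert h using 2
    simp [gateText]

end CoinWriter

theorem unaryEncodeNat_eq_replicate (n : ℕ) :
    Computability.unaryEncodeNat n = List.replicate n true := by
  induction n with
  | zero => rfl
  | succ n ih => rw [Computability.unaryEncodeNat, ih, List.replicate_succ]

open CoinWriter in
/-- The machine writes the descriptions of the circuits in polynomial time. -/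
noncomputable def coinWriterComputes :
    Turing.TM2ComputableInPolyTime
      (Computability.encodingProd Computability.unaryEncodingNat
        Computability.unaryEncodingNat).encode
      writeCircuit (fun a : ℕ × ℕ => [(List.finRange a.1).map fun i : Fin a.1 => rotationCode i]) where
  tm := machine rotationText
  inputAlphabet := Equiv.refl _
  outputAlphabet := Equiv.refl _
  time := .X ^ 2 + 2 * .X + 3
  outputsFun := by
    rintro ⟨n, k⟩
    have hin : (Computability.encodingProd Computability.unaryEncodingNat
        Computability.unaryEncodingNat).encode (n, k) =
        List.replicate n (.inl true) ++ List.replicate k (.inr true) := by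
      simp [Computability.encodingProd, Computability.unaryEncodingNat,
        unaryEncodeNat_eq_replicate]
    have hout : writeCircuit [(List.finRange n).map fun i : Fin n => rotationCode i] =
        (List.range n).flatMap (gateText rotationText) ++ [.endLayer] := by
      rw [← List.map_coe_finRange_eq_range, List.flatMap_map]
      simp [writeCircuit, List.flatMap_map, rotationCode_write, gateText]
    have hrun := runs_loop rotationText n k [.endLayer]
    have h0 : Runs rotationText 1 (config (some .start) false
        (List.replicate n (.inl true) ++ List.replicate k (.inr true)) [] [])
        (config (some .loop) false
          (List.replicate n (.inl true) ++ List.replicate k (.inr true)) [] [.endLayer]) := by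
      refine Runs.of_step (congrArg some ?_)
      change (⟨_, _, _⟩ : Turing.TM2.Cfg Alphabet Label Bool) = ⟨_, _, _⟩
      congr 1
      funext k
      cases k <;> rfl
    refine ⟨⟨hrun.choose + 1, ?_⟩, ?_⟩
    · have h := h0.trans hrun.choose_spec.2
      rw [hin, hout]
      refine Eq.trans (congrArg (fun s => (flip Bind.bind (Turing.TM2.step (program rotationText)))^[_] (some s)) ?_)
        (Eq.trans h (congrArg some ?_))
      · change (⟨_, _, _⟩ : Turing.TM2.Cfg Alphabet Label Bool) = ⟨_, _, _⟩
        congr 1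
        funext k
        cases k
        · exact List.map_id _
        · rfl
        · rfl
      · change (⟨_, _, _⟩ : Turing.TM2.Cfg Alphabet Label Bool) = ⟨_, _, _⟩
        congr 1
        funext k
        cases k
        · rfl
        · rfl
        · exact (List.map_id _).symm
    · refine (Nat.add_le_add_right hrun.choose_spec.1 1).trans ?_
      have hlen := congrArg List.length hin
      rw [List.length_append, List.length_replicate, List.length_replicate] at hlen
      rw [hlen]
      simp only [Polynomial.eval_add, Polynomial.eval_pow, Polynomial.eval_X, Polynomial.eval_mul,
        Polynomial.eval_ofNat]
      nlinarith

theorem coinCircuit_isUniformFamily : IsUniformFamily coinCircuit := by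
  refine ⟨_, fun n k => ?_, ⟨coinWriterComputes⟩⟩
  refine .cons ?_ .nil
  rw [List.forall₂_map_left_iff, List.forall₂_map_right_iff, List.forall₂_same]
  exact fun i _ => rotationCode_describes k i

/-! ### Total variation distance -/

/-- Pointwise, the minimum is half of the sum minus half of the absolute difference. The overlap on
the right is what the later estimates bound. -/
theorem one_sub_tvDist {α : Type*} [Fintype α] {P Q : α → ℝ} (hP : ∑ a, P a = 1)
    (hQ : ∑ a, Q a = 1) : 1 - tvDist P Q = ∑ a, min (P a) (Q a) := by
  have h : ∀ a, min (P a) (Q a) = (1 / 2) * (P a + Q a) - (1 / 2) * |P a - Q a| := fun a => by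
    rcases le_total (P a) (Q a) with hle | hle
    · rw [min_eq_left hle, abs_of_nonpos (by linarith)]; ring
    · rw [min_eq_right hle, abs_of_nonneg (by linarith)]; ring
  simp_rw [h]
  rw [Finset.sum_sub_distrib, ← Finset.mul_sum, ← Finset.mul_sum, Finset.sum_add_distrib, hP, hQ,
    tvDist]
  norm_num

/-- Total variation distance does not increase under a map. -/
theorem tvDist_map_le {α β : Type*} [Fintype α] [Fintype β] [DecidableEq β] (φ : α → β)
    (P Q : α → ℝ) :
    tvDist (fun b => ∑ a with φ a = b, P a) (fun b => ∑ a with φ a = b, Q a) ≤ tvDist P Q := by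
  rw [tvDist, tvDist]
  refine mul_le_mul_of_nonneg_left ?_ (by norm_num)
  calc ∑ b, |∑ a with φ a = b, P a - ∑ a with φ a = b, Q a|
      ≤ ∑ b, ∑ a with φ a = b, |P a - Q a| := Finset.sum_le_sum fun b _ => by
        rw [← Finset.sum_sub_distrib]
        exact Finset.abs_sum_le_sum_abs _ _
    _ = ∑ a, |P a - Q a| := Finset.sum_fiberwise _ _ _

theorem sqrt_sum_le_sum_sqrt {α : Type*} (s : Finset α) (f : α → ℝ) (hf : ∀ a, 0 ≤ f a) :
    √(∑ a ∈ s, f a) ≤ ∑ a ∈ s, √(f a) := by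
  classical
  induction s using Finset.induction_on with
  | empty => simp
  | insert a s ha ih =>
    rw [Finset.sum_insert ha, Finset.sum_insert ha]
    refine (Real.sqrt_le_iff.2 ⟨by positivity, ?_⟩).trans (add_le_add_right ih _)
    rw [add_sq, Real.sq_sqrt (hf a), Real.sq_sqrt (Finset.sum_nonneg fun b _ => hf b)]
    have : 0 ≤ √(f a) * √(∑ b ∈ s, f b) := by positivity
    linarith

/-- If `P` is a uniform mixture of `r` distributions, each of which has Bhattacharyya coefficient
at most `B` with `Q`, then the overlap of `P` and `Q` is at most `√r * B`. -/
theorem sum_min_mixture_le {α R : Type*} [Fintype α] [Fintype R] [Nonempty R] (P : R → α → ℝ)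
    (Q : α → ℝ) (hP : ∀ r a, 0 ≤ P r a) (hQ : ∀ a, 0 ≤ Q a) {B : ℝ}
    (hB : ∀ r, ∑ a, √(P r a * Q a) ≤ B) :
    ∑ a, min ((∑ r, P r a) / Fintype.card R) (Q a) ≤ √(Fintype.card R) * B := by
  have hc : (0 : ℝ) < Fintype.card R := by exact_mod_cast Fintype.card_pos
  calc ∑ a, min ((∑ r, P r a) / Fintype.card R) (Q a)
      ≤ ∑ a, ∑ r, √((Fintype.card R : ℝ)⁻¹) * √(P r a * Q a) := by
        refine Finset.sum_le_sum fun a _ => ?_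
        have hp : 0 ≤ (∑ r, P r a) / (Fintype.card R : ℝ) :=
          div_nonneg (Finset.sum_nonneg fun r _ => hP r a) hc.le
        -- The minimum of two nonnegative numbers is at most their geometric mean.
        have h1 : min ((∑ r, P r a) / Fintype.card R) (Q a) ≤
            √((∑ r, P r a) / Fintype.card R * Q a) := by
          refine Real.le_sqrt_of_sq_le ?_
          rw [sq]
          exact mul_le_mul (min_le_left _ _) (min_le_right _ _) (le_min hp (hQ a)) hp
        refine h1.trans ?_
        have h2 : (∑ r, P r a) / Fintype.card R * Q a =
            ∑ r, (Fintype.card R : ℝ)⁻¹ * (P r a * Q a) := by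
          rw [← Finset.mul_sum, ← Finset.sum_mul]; ring
        rw [h2]
        -- Splitting under the square root is what makes the mixture cost √r instead of r.
        refine (sqrt_sum_le_sum_sqrt _ _ fun r => ?_).trans_eq ?_
        · exact mul_nonneg (inv_nonneg.2 hc.le) (mul_nonneg (hP r a) (hQ a))
        · exact Finset.sum_congr rfl fun r _ => Real.sqrt_mul (inv_nonneg.2 hc.le) _
    _ = √((Fintype.card R : ℝ)⁻¹) * ∑ r, ∑ a, √(P r a * Q a) := by
        rw [Finset.sum_comm, Finset.mul_sum]
        exact Finset.sum_congr rfl fun r _ => (Finset.mul_sum _ _ _).symm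
    _ ≤ √((Fintype.card R : ℝ)⁻¹) * (Fintype.card R * B) := by
        refine mul_le_mul_of_nonneg_left ?_ (Real.sqrt_nonneg _)
        refine (Finset.sum_le_sum fun r _ => hB r).trans_eq ?_
        rw [Finset.sum_const, Finset.card_univ, nsmul_eq_mul]
    _ = √(Fintype.card R) * B := by
        rw [Real.sqrt_inv, ← mul_assoc]
        congr 1
        nth_rewrite 2 [← Real.mul_self_sqrt hc.le]
        field_simp

/-! ### Bernoulli distributions -/

theorem bernoulliMass_nonneg {p : ℝ} (h0 : 0 ≤ p) (h1 : p ≤ 1) (b : Bool) :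
    0 ≤ bernoulliMass p b := by
  cases b <;> simp [bernoulliMass, h0, h1]

theorem sum_bernoulliMass (p : ℝ) : ∑ b, bernoulliMass p b = 1 := by
  simp [bernoulliMass]

theorem sum_prod_bernoulliMass {ι : Type*} [Fintype ι] [DecidableEq ι] (p : ℝ) :
    ∑ y : ι → Bool, ∏ i, bernoulliMass p (y i) = 1 := by
  rw [← Fintype.piFinset_univ, ← Finset.prod_univ_sum]
  simp only [sum_bernoulliMass, Finset.prod_const_one]

/-- With a, b, c, d the square roots of p, 1-p, q, 1-q, one has 1 - (ac + bd) = ((a-c)² + (b-d)²)/2.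
Both squares are at least (p-q)²/4, as sums of two of the roots are at most 2; then 1 + x ≤ exp x.
-/
theorem bhattacharyya_bernoulli_le {p q : ℝ} (hp0 : 0 ≤ p) (hp1 : p ≤ 1) (hq0 : 0 ≤ q)
    (hq1 : q ≤ 1) :
    ∑ b, √(bernoulliMass p b * bernoulliMass q b) ≤ Real.exp (-(p - q) ^ 2 / 4) := by
  have hp1' : 0 ≤ 1 - p := by linarith
  have hq1' : 0 ≤ 1 - q := by linarith
  refine le_trans ?_ (Real.add_one_le_exp _)
  simp only [bernoulliMass, Fintype.sum_bool, if_true, Bool.false_eq_true, if_false]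
  rw [Real.sqrt_mul hp0, Real.sqrt_mul hp1']
  have ha := Real.sq_sqrt hp0
  have hb := Real.sq_sqrt hp1'
  have hc := Real.sq_sqrt hq0
  have hd := Real.sq_sqrt hq1'
  have ha1 : √p ≤ 1 := Real.sqrt_le_one.2 hp1
  have hb1 : √(1 - p) ≤ 1 := Real.sqrt_le_one.2 (by linarith)
  have hc1 : √q ≤ 1 := Real.sqrt_le_one.2 hq1
  have hd1 : √(1 - q) ≤ 1 := Real.sqrt_le_one.2 (by linarith)
  have ha0 := Real.sqrt_nonneg p
  have hb0 := Real.sqrt_nonneg (1 - p)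
  have hc0 := Real.sqrt_nonneg q
  have hd0 := Real.sqrt_nonneg (1 - q)
  generalize √p = a at *
  generalize √(1 - p) = b at *
  generalize √q = c at *
  generalize √(1 - q) = d at *
  have key : ∀ u v : ℝ, 0 ≤ u → 0 ≤ v → u ≤ 1 → v ≤ 1 →
      (u ^ 2 - v ^ 2) ^ 2 ≤ 4 * (u - v) ^ 2 := fun u v hu hv hu1 hv1 => by
    have h : (u ^ 2 - v ^ 2) ^ 2 = (u + v) ^ 2 * (u - v) ^ 2 := by ring
    rw [h]
    exact mul_le_mul_of_nonneg_right (by nlinarith) (sq_nonneg _)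
  have h1 := key a c ha0 hc0 ha1 hc1
  have h2 := key b d hb0 hd0 hb1 hd1
  have h3 : b ^ 2 - d ^ 2 = -(p - q) := by rw [hb, hd]; ring
  have h4 : a ^ 2 - c ^ 2 = p - q := by rw [ha, hc]
  rw [h4] at h1
  rw [h3, neg_sq] at h2
  nlinarith

/-- The Bhattacharyya coefficient of two product distributions whose factors differ by `η`. -/
theorem bhattacharyya_prod_le {ι : Type*} [Fintype ι] [DecidableEq ι] (p : ι → ℝ) {q η : ℝ}
    (hp0 : ∀ i, 0 ≤ p i) (hp1 : ∀ i, p i ≤ 1) (hq0 : 0 ≤ q) (hq1 : q ≤ 1) (hη : 0 ≤ η)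
    (h : ∀ i, η ≤ |p i - q|) :
    ∑ y : ι → Bool, √((∏ i, bernoulliMass (p i) (y i)) * ∏ i, bernoulliMass q (y i)) ≤
      Real.exp (-(Fintype.card ι * η ^ 2) / 4) := by
  have h1 : ∀ y : ι → Bool,
      √((∏ i, bernoulliMass (p i) (y i)) * ∏ i, bernoulliMass q (y i)) =
        ∏ i, √(bernoulliMass (p i) (y i) * bernoulliMass q (y i)) := fun y => by
    rw [← Finset.prod_mul_distrib, Real.sqrt_prod]
    exact fun i _ => mul_nonneg (bernoulliMass_nonneg (hp0 i) (hp1 i) _)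
      (bernoulliMass_nonneg hq0 hq1 _)
  simp_rw [h1]
  rw [← Fintype.piFinset_univ,
    ← Finset.prod_univ_sum (f := fun i b => √(bernoulliMass (p i) b * bernoulliMass q b))]
  have h2 : ∀ i, ∑ b, √(bernoulliMass (p i) b * bernoulliMass q b) ≤ Real.exp (-η ^ 2 / 4) :=
    fun i => by
      refine (bhattacharyya_bernoulli_le (hp0 i) (hp1 i) hq0 hq1).trans (Real.exp_le_exp.2 ?_)
      have : η ^ 2 ≤ (p i - q) ^ 2 := by
        rw [← sq_abs (p i - q)]
        exact pow_le_pow_left₀ hη (h i) 2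
      linarith
  refine (Finset.prod_le_prod (fun i _ => Finset.sum_nonneg fun b _ => Real.sqrt_nonneg _)
    fun i _ => h2 i).trans_eq ?_
  rw [Finset.prod_const, Finset.card_univ, ← Real.exp_nat_mul]
  congr 1
  ring

/-! ### Functions of uniform bits -/

/-- The mean of a function of independent uniform bits. -/
noncomputable def cubeMean {ι : Type*} [Fintype ι] [DecidableEq ι] (f : (ι → Bool) → ℝ) : ℝ :=
  (∑ x, f x) / 2 ^ Fintype.card ι

/-- The assignment that is `r` on `T` and `x` elsewhere. -/
def glue {ι : Type*} [DecidableEq ι] (T : Finset ι) (r : {i // i ∈ T} → Bool)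
    (x : {i // i ∉ T} → Bool) : ι → Bool :=
  (Equiv.piEquivPiSubtypeProd (fun i => i ∈ T) fun _ => Bool).symm (r, x)

theorem glue_of_mem {ι : Type*} [DecidableEq ι] (T : Finset ι) (r : {i // i ∈ T} → Bool)
    (x : {i // i ∉ T} → Bool) {i : ι} (hi : i ∈ T) : glue T r x i = r ⟨i, hi⟩ := dif_pos hi

theorem glue_of_notMem {ι : Type*} [DecidableEq ι] (T : Finset ι) (r : {i // i ∈ T} → Bool)
    (x : {i // i ∉ T} → Bool) {i : ι} (hi : i ∉ T) : glue T r x i = x ⟨i, hi⟩ := dif_neg hi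

section CubeMean

variable {ι : Type*} [Fintype ι] [DecidableEq ι]

/-- Exchange the coordinates outside `S` between two independent samples `x`, `y`. This is a
bijection on pairs, and `a x * b y` becomes a product of `a` and `b` at the same new first sample,
because `b` reads only coordinates outside `S`. The second sample is then free. -/
theorem cubeMean_mul {S S' : Set ι} (hS : Disjoint S S') {a b : (ι → Bool) → ℝ}
    (ha : DependsOn a S) (hb : DependsOn b S') :
    cubeMean (fun x => a x * b x) = cubeMean a * cubeMean b := by
  classical
  let mix : (ι → Bool) → (ι → Bool) → ι → Bool := fun x y i => if i ∈ S then x i else y i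
  let e : (ι → Bool) × (ι → Bool) ≃ (ι → Bool) × (ι → Bool) :=
    Function.Involutive.toPerm (fun z => (mix z.1 z.2, mix z.2 z.1)) fun z => by
      ext i
      all_goals
        by_cases hi : i ∈ S <;> simp [mix, hi]
  have he : ∀ z, (e z).1 = mix z.1 z.2 := fun z => rfl
  have h1 : ∀ z : (ι → Bool) × (ι → Bool), a z.1 * b z.2 = a (e z).1 * b (e z).1 := fun z => by
    have hae : a z.1 = a (e z).1 := ha fun i hi => by
      simp [he, mix, hi]
    have hbe : b z.2 = b (e z).1 := hb fun i hi => by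
      have : i ∉ S := fun h => Set.disjoint_left.1 hS h hi
      simp [he, mix, this]
    rw [hae, hbe]
  have h2 : (∑ x, a x) * ∑ y, b y = 2 ^ Fintype.card ι * ∑ x, a x * b x := by
    rw [Finset.sum_mul_sum, ← Fintype.sum_prod_type', Finset.sum_congr rfl fun z _ => h1 z,
      e.sum_comp fun z => a z.1 * b z.1, Fintype.sum_prod_type, Finset.mul_sum]
    simp
  rw [cubeMean, cubeMean, cubeMean, div_mul_div_comm, h2]
  field_simp

theorem cubeMean_one : cubeMean (fun _ : ι → Bool => (1 : ℝ)) = 1 := by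
  simp [cubeMean]

theorem cubeMean_prod {o : Type*} (I : Finset o) {S : o → Set ι}
    (hS : (I : Set o).PairwiseDisjoint S) {a : o → (ι → Bool) → ℝ}
    (ha : ∀ i, DependsOn (a i) (S i)) :
    cubeMean (fun x => ∏ i ∈ I, a i x) = ∏ i ∈ I, cubeMean (a i) := by
  classical
  induction I using Finset.induction_on with
  | empty => simp [cubeMean_one]
  | insert i I hi ih =>
    rw [Finset.coe_insert] at hS
    simp_rw [Finset.prod_insert hi]
    rw [← ih (hS.subset (Set.subset_insert _ _))]
    refine cubeMean_mul (S' := ⋃ j ∈ I, S j) ?_ (ha i) fun x y hxy => ?_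
    · rw [Set.disjoint_iUnion₂_right]
      intro j hj
      exact hS (Set.mem_insert _ _) (Set.mem_insert_of_mem _ hj) fun h => hi (h ▸ hj)
    · exact Finset.prod_congr rfl fun j hj => ha j fun k hk =>
        hxy k (Set.mem_iUnion₂.2 ⟨j, hj, hk⟩)

theorem sum_glue (T : Finset ι) (f : (ι → Bool) → ℝ) :
    ∑ x, f x = ∑ r, ∑ x, f (glue T r x) := by
  rw [← Fintype.sum_prod_type']
  exact ((Equiv.piEquivPiSubtypeProd (fun i => i ∈ T) fun _ => Bool).symm.sum_comp f).symm

theorem two_pow_card_split (T : Finset ι) :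
    (2 : ℝ) ^ Fintype.card ι = 2 ^ T.card * 2 ^ Fintype.card {i // i ∉ T} := by
  rw [← pow_add, Fintype.card_subtype_compl, Fintype.card_coe,
    Nat.add_sub_cancel' (Finset.card_le_univ T)]

/-- Conditioning on the bits in `T`; this is the source of the uniform mixture. -/
theorem cubeMean_eq_glue (T : Finset ι) (f : (ι → Bool) → ℝ) :
    cubeMean f = (∑ r : {i // i ∈ T} → Bool, cubeMean fun x => f (glue T r x)) /
      Fintype.card ({i // i ∈ T} → Bool) := by
  simp_rw [cubeMean]
  rw [sum_glue T, ← Finset.sum_div, div_div, two_pow_card_split T, mul_comm]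
  simp

/-- The probability that a Boolean function of uniform bits is true. -/
noncomputable def trueProb (f : (ι → Bool) → Bool) : ℝ :=
  cubeMean fun x => if f x = true then 1 else 0

theorem trueProb_nonneg (f : (ι → Bool) → Bool) : 0 ≤ trueProb f :=
  div_nonneg (Finset.sum_nonneg fun x _ => by split_ifs <;> norm_num) (by positivity)

theorem cubeMean_eq_bernoulliMass (f : (ι → Bool) → Bool) (b : Bool) :
    cubeMean (fun x => if f x = b then 1 else 0) = bernoulliMass (trueProb f) b := by
  cases b
  · have h : ∀ x, (if f x = false then (1 : ℝ) else 0) = 1 - if f x = true then 1 else 0 :=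
      fun x => by cases f x <;> simp
    simp_rw [h]
    have h1 := cubeMean_one (ι := ι)
    rw [cubeMean] at h1
    rw [cubeMean, Finset.sum_sub_distrib, sub_div, h1]
    simp [bernoulliMass, trueProb, cubeMean]
  · simp [bernoulliMass, trueProb]

theorem trueProb_le_one (f : (ι → Bool) → Bool) : trueProb f ≤ 1 := by
  have h : 0 ≤ bernoulliMass (trueProb f) false := by
    rw [← cubeMean_eq_bernoulliMass]
    exact div_nonneg (Finset.sum_nonneg fun x _ => by split_ifs <;> norm_num) (by positivity)
  simpa [bernoulliMass] using h

/-- The probability that a function of `d` uniform bits is true is a multiple of `2⁻ᵈ`. -/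
theorem trueProb_eq_div {f : (ι → Bool) → Bool} {S : Finset ι} (hf : DependsOn f (S : Set ι))
    {d : ℕ} (hd : S.card ≤ d) : ∃ k : ℕ, trueProb f = k / 2 ^ d := by
  have h : ∀ r : {i // i ∈ S} → Bool, ∀ x, (if f (glue S r x) = true then (1 : ℝ) else 0) =
      if f (glue S r fun _ => false) = true then 1 else 0 := fun r x => by
    have hx : f (glue S r x) = f (glue S r fun _ => false) := hf fun i hi => by
      rw [glue_of_mem S r _ hi, glue_of_mem S r _ hi]
    rw [hx]
  -- The number of accepted assignments to `S`, rescaled from denominator 2^|S| to 2^d.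
  refine ⟨(Finset.univ.filter fun r => f (glue S r fun _ => false) = true).card *
    2 ^ (d - S.card), ?_⟩
  rw [trueProb, cubeMean_eq_glue S]
  simp_rw [h, cubeMean]
  have hd' : (2 : ℝ) ^ d = 2 ^ (d - S.card) * 2 ^ S.card := by
    rw [← pow_add, Nat.sub_add_cancel hd]
  rw [hd']
  have hpos : (2 : ℝ) ^ Fintype.card {i // i ∉ S} ≠ 0 := by positivity
  have hcard : (Fintype.card ({i // i ∉ S} → Bool) : ℝ) = 2 ^ Fintype.card {i // i ∉ S} := by
    simp
  simp only [Finset.sum_const, Finset.card_univ, nsmul_eq_mul, hcard,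
    mul_div_cancel_left₀ _ hpos, Finset.sum_boole]
  simp
  field_simp

/-- Over the common denominator 25·2^d the difference has the integer numerator 25k - 16·2^d, which
is nonzero because 5 divides 25k but not a power of two. -/
theorem le_abs_trueProb_sub {f : (ι → Bool) → Bool} {S : Finset ι}
    (hf : DependsOn f (S : Set ι)) {d : ℕ} (hd : S.card ≤ d) :
    1 / (25 * 2 ^ d) ≤ |trueProb f - 16 / 25| := by
  obtain ⟨k, hk⟩ := trueProb_eq_div hf hd
  have hne : (25 * k - 16 * 2 ^ d : ℤ) ≠ 0 := by
    intro h
    have h1 : (5 : ℤ) ∣ 16 * 2 ^ d := ⟨5 * k, by linarith⟩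
    have h2 : (5 : ℕ) ∣ 2 ^ (4 + d) := by
      rw [pow_add]
      exact_mod_cast h1
    have h3 := Nat.Prime.dvd_of_dvd_pow (by norm_num) h2
    omega
  have h1 : (1 : ℝ) ≤ |25 * (k : ℝ) - 16 * 2 ^ d| := by exact_mod_cast Int.one_le_abs hne
  have h2 : (k : ℝ) / 2 ^ d - 16 / 25 = (25 * k - 16 * 2 ^ d) / (25 * 2 ^ d) := by
    field_simp
  rw [hk, h2, abs_div, abs_of_pos (show (0 : ℝ) < 25 * 2 ^ d by positivity)]
  exact div_le_div_of_nonneg_right h1 (by positivity)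

end CubeMean

/-! ### Local functions do not sample biased bits -/

/-- The fibre is a box, free in the coordinates outside `I`, and each free coordinate sums to 1. -/
theorem sum_filter_prod_bernoulliMass {o : Type*} [Fintype o] [DecidableEq o] (q : ℝ)
    (I : Finset o) (z : I → Bool) :
    ∑ y : o → Bool with (fun i : I => y i) = z, ∏ i, bernoulliMass q (y i) =
      ∏ i, bernoulliMass q (z i) := by
  have h : Finset.univ.filter (fun y : o → Bool => (fun i : I => y i) = z) =
      Fintype.piFinset fun i => if hi : i ∈ I then {z ⟨i, hi⟩} else Finset.univ := by
    ext y
    simp only [Finset.mem_filter_univ, Fintype.mem_piFinset, funext_iff, Subtype.forall]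
    refine forall_congr' fun i => ?_
    by_cases hi : i ∈ I <;> simp [hi]
  rw [h, ← Finset.prod_univ_sum, ← Finset.prod_subset (Finset.subset_univ I)]
  · rw [← Finset.prod_coe_sort I]
    simp
  · intro i _ hi
    simp only [hi, dite_false, sum_bernoulliMass]

section LocalFunctions

variable {ι o : Type*} [Fintype ι] [DecidableEq ι] [Fintype o] [DecidableEq o]

/-- The distribution of the values of functions of uniform bits. -/
noncomputable def valueDist (f : o → (ι → Bool) → Bool) (y : o → Bool) : ℝ :=
  cubeMean fun x => if (fun i => f i x) = y then 1 else 0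

theorem sum_filter_valueDist {β : Type*} [DecidableEq β] (f : o → (ι → Bool) → Bool)
    (φ : (o → Bool) → β) (z : β) :
    ∑ y with φ y = z, valueDist f y =
      cubeMean fun x => if φ (fun i => f i x) = z then 1 else 0 := by
  simp_rw [valueDist, cubeMean]
  rw [← Finset.sum_div, Finset.sum_comm]
  congr 1
  refine Finset.sum_congr rfl fun x _ => ?_
  rw [Finset.sum_ite_eq]
  simp

theorem sum_valueDist (f : o → (ι → Bool) → Bool) : ∑ y, valueDist f y = 1 := by
  have h := sum_filter_valueDist f (fun _ => ()) ()
  simpa [cubeMean_one] using h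

/-- If every function depends on at most `d` bits, and the functions in `I` depend on disjoint sets
of bits once the bits in `T` are fixed, then the values of the functions are far from independent
bits of bias `16/25`. -/
theorem one_sub_tvDist_valueDist_le (f : o → (ι → Bool) → Bool) (S : o → Finset ι)
    (hf : ∀ i, DependsOn (f i) (S i : Set ι)) {d : ℕ} (hd : ∀ i, (S i).card ≤ d)
    (T : Finset ι) (I : Finset o) (hI : (I : Set o).PairwiseDisjoint fun i => S i \ T) :
    1 - tvDist (valueDist f) (fun y => ∏ i, bernoulliMass (16 / 25) (y i)) ≤
      √(2 ^ T.card) * Real.exp (-(I.card * (1 / (25 * 2 ^ d)) ^ 2) / 4) := by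
  -- Discard the outputs outside `I`: passing to the marginal can only decrease the distance.
  have hmap := tvDist_map_le (fun (y : o → Bool) (i : I) => y i) (valueDist f)
    (fun y => ∏ i, bernoulliMass (16 / 25) (y i))
  refine (sub_le_sub_left hmap 1).trans ?_
  have hQ : (fun z : I → Bool => ∑ y : o → Bool with (fun i : I => y i) = z,
      ∏ i, bernoulliMass (16 / 25) (y i)) =
        fun z => ∏ i, bernoulliMass (16 / 25) (z i) :=
    funext fun z => sum_filter_prod_bernoulliMass _ _ z
  let S' : o → Finset {i // i ∉ T} := fun i => (S i).subtype fun j => j ∉ T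
  have hS'card : ∀ i, (S' i).card ≤ d := fun i => by
    refine le_trans ?_ (hd i)
    rw [Finset.card_subtype]
    exact Finset.card_filter_le _ _
  have hS'dep : ∀ i r, DependsOn (fun x => f i (glue T r x)) (S' i : Set {i // i ∉ T}) :=
    fun i r x y hxy => hf i fun j hj => by
      by_cases hjT : j ∈ T
      · rw [glue_of_mem T r _ hjT, glue_of_mem T r _ hjT]
      · rw [glue_of_notMem T r _ hjT, glue_of_notMem T r _ hjT]
        exact hxy ⟨j, hjT⟩ (by simpa [S'] using hj)
  have hS'disj : ((Finset.univ : Finset I) : Set I).PairwiseDisjoint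
      fun i : I => (S' i : Set {i // i ∉ T}) := by
    intro i _ j _ hij
    have h := hI i.2 j.2 fun h => hij (Subtype.ext h)
    refine Set.disjoint_left.2 fun k hk hk' => ?_
    exact Finset.disjoint_left.1 h
      (Finset.mem_sdiff.2 ⟨Finset.mem_subtype.1 (Finset.mem_coe.1 hk), k.2⟩)
      (Finset.mem_sdiff.2 ⟨Finset.mem_subtype.1 (Finset.mem_coe.1 hk'), k.2⟩)
  -- Once the bits in `T` are fixed to `r`, the outputs in `I` are independent, so the marginal is a
  -- uniform mixture of product distributions.
  have hP : (fun z : I → Bool => ∑ y : o → Bool with (fun i : I => y i) = z, valueDist f y) =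
      fun z => (∑ r : {i // i ∈ T} → Bool,
        ∏ i : I, bernoulliMass (trueProb fun x => f i (glue T r x)) (z i)) /
          Fintype.card ({i // i ∈ T} → Bool) := by
    funext z
    rw [sum_filter_valueDist f (fun (y : o → Bool) (i : I) => y i), cubeMean_eq_glue T]
    congr 1
    refine Finset.sum_congr rfl fun r _ => ?_
    have hprod : ∀ x, (if (fun i : I => f i (glue T r x)) = z then (1 : ℝ) else 0) =
        ∏ i : I, if f i (glue T r x) = z i then 1 else 0 := fun x => by
      rw [Finset.prod_ite_zero]
      simp [funext_iff]
    simp_rw [hprod]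
    rw [cubeMean_prod Finset.univ hS'disj
      (a := fun (i : I) x => if f i (glue T r x) = z i then 1 else 0)]
    · exact Finset.prod_congr rfl fun i _ => cubeMean_eq_bernoulliMass _ _
    · intro i x y hxy
      have := hS'dep i r hxy
      simp only at this ⊢
      rw [this]
  have hPsum : ∑ z : I → Bool, ∑ y : o → Bool with (fun i : I => y i) = z, valueDist f y = 1 := by
    rw [Finset.sum_fiberwise, sum_valueDist]
  rw [hQ, one_sub_tvDist hPsum (sum_prod_bernoulliMass _)]
  simp_rw [fun z => congrFun hP z]
  have hcard : ((2 : ℝ) ^ T.card) = Fintype.card ({i // i ∈ T} → Bool) := by simp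
  rw [hcard]
  refine sum_min_mixture_le _ _ (fun r z => ?_) (fun z => ?_) fun r => ?_
  · exact Finset.prod_nonneg fun i _ =>
      bernoulliMass_nonneg (trueProb_nonneg _) (trueProb_le_one _) _
  · exact Finset.prod_nonneg fun i _ => bernoulliMass_nonneg (by norm_num) (by norm_num) _
  · have h := bhattacharyya_prod_le (fun i : I => trueProb fun x => f i (glue T r x))
      (q := 16 / 25) (η := 1 / (25 * 2 ^ d)) (fun i => trueProb_nonneg _)
      (fun i => trueProb_le_one _) (by norm_num) (by norm_num) (by positivity)
      fun i => le_abs_trueProb_sub (hS'dep i r) (hS'card i)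
    rwa [Fintype.card_coe] at h

/-- Choice of a threshold for the number of sets that contain an element: few elements lie in many
sets, and many of the sets are disjoint away from these elements. -/
theorem exists_pairwiseDisjoint_sdiff (S : o → Finset ι) {d R : ℕ} (hd : ∀ i, (S i).card ≤ d)
    (hd0 : 0 < d) (hR : 1 < R) :
    ∃ j < 2 * d, ∃ (T : Finset ι) (I : Finset o),
      T.card * R ^ (j + 1) ≤ Fintype.card o * d ∧
      Fintype.card o ≤ 2 * (I.card * (1 + d * R ^ j)) ∧
      (I : Set o).PairwiseDisjoint fun i => S i \ T := by
  classical
  let N : ι → Finset o := fun v => Finset.univ.filter fun i => v ∈ S i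
  have hsum : ∑ v, (N v).card ≤ Fintype.card o * d := by
    have h := Finset.sum_card_bipartiteAbove_eq_sum_card_bipartiteBelow
      (s := (Finset.univ : Finset ι)) (t := (Finset.univ : Finset o)) fun v i => v ∈ S i
    simp only [Finset.bipartiteAbove, Finset.bipartiteBelow, Finset.filter_mem_eq_inter,
      Finset.univ_inter] at h
    rw [h]
    refine (Finset.sum_le_sum fun i _ => hd i).trans_eq ?_
    rw [Finset.sum_const, Finset.card_univ, smul_eq_mul]
  -- The outputs that read an input of degree in [R^j, R^(j+1)). An output has at most `d` inputs,
  -- so it is bad for at most `d` of the `2 * d` scales, and some scale is bad for at most half of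
  -- the outputs.
  let B : ℕ → Finset o := fun j =>
    Finset.univ.filter fun i => j ∈ (S i).image fun v => Nat.log R (N v).card
  obtain ⟨j, hj, hBj⟩ : ∃ j ∈ Finset.range (2 * d), (B j).card * 2 ≤ Fintype.card o := by
    refine Finset.exists_le_of_sum_le (by simpa using hd0.ne') ?_
    rw [Finset.sum_const, Finset.card_range, smul_eq_mul, ← Finset.sum_mul]
    have h := Finset.sum_card_bipartiteAbove_eq_sum_card_bipartiteBelow
      (s := Finset.range (2 * d)) (t := (Finset.univ : Finset o))
      fun j i => j ∈ (S i).image fun v => Nat.log R (N v).card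
    simp only [Finset.bipartiteAbove, Finset.bipartiteBelow] at h
    have h2 : ∑ j ∈ Finset.range (2 * d), (B j).card ≤ Fintype.card o * d := by
      refine (le_of_eq h).trans ?_
      calc _ ≤ ∑ _i : o, d := Finset.sum_le_sum fun i _ => by
            refine le_trans (Finset.card_le_card fun k hk => (Finset.mem_filter.1 hk).2) ?_
            exact Finset.card_image_le.trans (hd i)
        _ = _ := by rw [Finset.sum_const, Finset.card_univ, smul_eq_mul]
    nlinarith
  refine ⟨j, Finset.mem_range.1 hj, ?_⟩
  let T : Finset ι := Finset.univ.filter fun v => R ^ (j + 1) ≤ (N v).card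
  -- A maximal family of good outputs that are disjoint off `T`. Off `T` their inputs have degree at
  -- most R^j, so each member blocks at most d·R^j outputs, and by maximality every good output is a
  -- member or blocked.
  obtain ⟨I, hI⟩ := Finset.exists_maximal
    (s := ((B j)ᶜ : Finset o).powerset.filter fun I : Finset o => (I : Set o).PairwiseDisjoint fun i => S i \ T)
    ⟨∅, by simp⟩
  have hIB : I ⊆ (B j)ᶜ := Finset.mem_powerset.1 (Finset.mem_filter.1 hI.prop).1
  have hIdis := (Finset.mem_filter.1 hI.prop).2
  refine ⟨T, I, ?_, ?_, hIdis⟩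
  · calc T.card * R ^ (j + 1) = ∑ _v ∈ T, R ^ (j + 1) := by rw [Finset.sum_const, smul_eq_mul]
      _ ≤ ∑ v ∈ T, (N v).card := Finset.sum_le_sum fun v hv => (Finset.mem_filter.1 hv).2
      _ ≤ ∑ v, (N v).card := Finset.sum_le_sum_of_subset (Finset.subset_univ _)
      _ ≤ _ := hsum
  · have hlow : ∀ i ∈ I, ∀ v ∈ S i \ T, (N v).card ≤ R ^ j := fun i hi v hv => by
      have hiB := Finset.mem_compl.1 (hIB hi)
      rw [Finset.mem_sdiff] at hv
      have h1 : Nat.log R (N v).card ≠ j := fun h => hiB <| by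
        simp only [B, Finset.mem_filter_univ, Finset.mem_image]
        exact ⟨v, hv.1, h⟩
      have h2 : (N v).card < R ^ (j + 1) := by simpa [T] using hv.2
      have h3 := Nat.log_lt_of_lt_pow' (Nat.succ_ne_zero j) h2
      exact (Nat.lt_pow_of_log_lt hR (by omega)).le
    have hcover : (B j)ᶜ ⊆ I ∪ I.biUnion fun i => (S i \ T).biUnion N := by
      intro i hi
      by_contra hcon
      rw [Finset.mem_union, not_or] at hcon
      have hmem : insert i I ∈ ((B j)ᶜ : Finset o).powerset.filter
          fun I : Finset o => (I : Set o).PairwiseDisjoint fun i => S i \ T := by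
        rw [Finset.mem_filter, Finset.mem_powerset]
        refine ⟨Finset.insert_subset hi hIB, ?_⟩
        rw [Finset.coe_insert]
        refine hIdis.insert_of_notMem hcon.1 fun k hk => ?_
        refine Finset.disjoint_left.2 fun v hv hv' => hcon.2 ?_
        refine Finset.mem_biUnion.2 ⟨k, hk, Finset.mem_biUnion.2 ⟨v, hv', ?_⟩⟩
        exact Finset.mem_filter.2 ⟨Finset.mem_univ _, (Finset.mem_sdiff.1 hv).1⟩
      exact hcon.1 (hI.le_of_ge hmem (Finset.subset_insert _ _) (Finset.mem_insert_self _ _))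
    have hcov := (Finset.card_le_card hcover).trans (Finset.card_union_le _ _)
    have hbU : (I.biUnion fun i => (S i \ T).biUnion N).card ≤ I.card * (d * R ^ j) :=
      Finset.card_biUnion_le_card_mul _ _ _ fun i hi =>
        (Finset.card_biUnion_le_card_mul _ _ _ (hlow i hi)).trans
          (Nat.mul_le_mul_right _ ((Finset.card_le_card Finset.sdiff_subset).trans (hd i)))
    rw [Finset.card_compl] at hcov
    rw [mul_add, mul_one]
    omega

end LocalFunctions

/-- If every function depends on at most `d` bits and `d` is small compared with the number of
functions, then the values are at distance more than `1/3` from independent biased bits. -/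
theorem third_lt_tvDist_valueDist {ι o : Type*} [Fintype ι] [DecidableEq ι] [Fintype o]
    [DecidableEq o] (f : o → (ι → Bool) → Bool) (S : o → Finset ι)
    (hf : ∀ i, DependsOn (f i) (S i : Set ι)) {d : ℕ} (hd : ∀ i, (S i).card ≤ d) (hd0 : 0 < d)
    (hn : 2 * (10000 * d ^ 2 * 4 ^ d) ^ (2 * d) ≤ Fintype.card o) :
    1 / 3 < tvDist (valueDist f) (fun y => ∏ i, bernoulliMass (16 / 25) (y i)) := by
  -- The gain in the exponent is |I|/(2500·4^d). This `R` keeps the mixture cost |T|/2 below half of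
  -- it, and the lower bound on `Fintype.card o` makes the other half at least 1.
  set R : ℕ := 10000 * d ^ 2 * 4 ^ d with hRdef
  have hRge : 10000 ≤ R := by
    have h1 : 1 ≤ d ^ 2 := Nat.one_le_pow _ _ hd0
    have h2 : 1 ≤ 4 ^ d := Nat.one_le_pow _ _ (by norm_num)
    calc 10000 = 10000 * 1 * 1 := by norm_num
      _ ≤ R := Nat.mul_le_mul (Nat.mul_le_mul_left _ h1) h2
  obtain ⟨j, hj, T, I, hT, hI, hdis⟩ :=
    exists_pairwiseDisjoint_sdiff S hd hd0 (show 1 < R by omega)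
  have h := one_sub_tvDist_valueDist_le f S hf hd T I hdis
  have hx : 1 ≤ R ^ j := Nat.one_le_pow _ _ (by omega)
  have hI' : Fintype.card o ≤ 4 * I.card * d * R ^ j := by
    have h1 : 1 + d * R ^ j ≤ 2 * (d * R ^ j) := by nlinarith
    calc Fintype.card o ≤ 2 * (I.card * (1 + d * R ^ j)) := hI
      _ ≤ 2 * (I.card * (2 * (d * R ^ j))) := by gcongr
      _ = _ := by ring
  have hTm : T.card * (10000 * 4 ^ d) ≤ 4 * I.card := by
    have h1 : T.card * (10000 * 4 ^ d) * (d ^ 2 * R ^ j) ≤ 4 * I.card * (d ^ 2 * R ^ j) := by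
      calc T.card * (10000 * 4 ^ d) * (d ^ 2 * R ^ j) = T.card * R ^ (j + 1) := by
            rw [pow_succ, hRdef]; ring
        _ ≤ Fintype.card o * d := hT
        _ ≤ 4 * I.card * d * R ^ j * d := Nat.mul_le_mul_right _ hI'
        _ = _ := by ring
    exact Nat.le_of_mul_le_mul_right h1 (by positivity)
  have hm : 5000 * 4 ^ d ≤ I.card := by
    have h1 : R ^ (j + 1) ≤ R ^ (2 * d) := Nat.pow_le_pow_right (by omega) hj
    have h2 : 5000 * 4 ^ d * (4 * d * R ^ j) ≤ I.card * (4 * d * R ^ j) := by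
      calc 5000 * 4 ^ d * (4 * d * R ^ j) ≤ 5000 * 4 ^ d * (4 * d * R ^ j) * d :=
            Nat.le_mul_of_pos_right _ hd0
        _ = 2 * R ^ (j + 1) := by rw [pow_succ, hRdef]; ring
        _ ≤ Fintype.card o := (Nat.mul_le_mul_left _ h1).trans hn
        _ ≤ _ := hI'
        _ = _ := by ring
    exact Nat.le_of_mul_le_mul_right h2 (by positivity)
  have hsqrt : √(2 ^ T.card) ≤ Real.exp (T.card / 2) := by
    rw [Real.exp_half]
    refine Real.sqrt_le_sqrt ?_
    have h2 : (2 : ℝ) ≤ Real.exp 1 := by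
      have := Real.add_one_le_exp (1 : ℝ)
      linarith
    calc (2 : ℝ) ^ T.card ≤ Real.exp 1 ^ T.card := pow_le_pow_left₀ (by norm_num) h2 _
      _ = Real.exp T.card := by rw [← Real.exp_nat_mul, mul_one]
  have hTm' : (T.card : ℝ) * (10000 * 4 ^ d) ≤ 4 * I.card := by exact_mod_cast hTm
  have hm' : (5000 : ℝ) * 4 ^ d ≤ I.card := by exact_mod_cast hm
  have hexp : (T.card : ℝ) / 2 + -(I.card * (1 / (25 * 2 ^ d)) ^ 2) / 4 ≤ -1 := by
    have hq : (0 : ℝ) < 4 ^ d := by positivity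
    have h4 : ((2 : ℝ) ^ d) ^ 2 = 4 ^ d := by
      rw [← pow_mul, mul_comm, pow_mul]; norm_num
    have h5 : -(I.card * (1 / (25 * 2 ^ d)) ^ 2) / 4 = -((I.card : ℝ) / (2500 * 4 ^ d)) := by
      rw [← h4]; field_simp; ring
    have h6 : (T.card : ℝ) / 2 ≤ I.card / (5000 * 4 ^ d) := by
      rw [le_div_iff₀ (by positivity)]
      linarith
    have h7 : (1 : ℝ) ≤ I.card / (5000 * 4 ^ d) := by
      rw [le_div_iff₀ (by positivity)]
      linarith
    have h8 : (I.card : ℝ) / (2500 * 4 ^ d) = 2 * (I.card / (5000 * 4 ^ d)) := by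
      field_simp; ring
    rw [h5, h8]
    linarith
  have hfin : √(2 ^ T.card) * Real.exp (-(I.card * (1 / (25 * 2 ^ d)) ^ 2) / 4) ≤
      Real.exp (-1) := by
    refine (mul_le_mul_of_nonneg_right hsqrt (Real.exp_pos _).le).trans ?_
    rw [← Real.exp_add]
    exact Real.exp_le_exp.2 hexp
  have he : Real.exp (-1) < 2 / 3 := by
    have := Real.exp_neg_one_lt_d9
    linarith
  linarith

/-! ### Locality of shallow circuits -/

theorem Wire.exists_dependsOn {ℓ s : ℕ} {v : (Fin ℓ → Bool) → Fin s → Bool} {D : Fin s → ℕ}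
    (h : ∀ j, ∃ S : Finset (Fin ℓ), S.card ≤ 2 ^ D j ∧ DependsOn (fun x => v x j) (S : Set (Fin ℓ)))
    (w : Wire ℓ s) :
    ∃ S : Finset (Fin ℓ), S.card ≤ 2 ^ w.depth D ∧
      DependsOn (fun x => w.value x (v x)) (S : Set (Fin ℓ)) := by
  cases w with
  | input i => exact ⟨{i}, by simp [Wire.depth], fun x y hxy => hxy i (by simp)⟩
  | gate j => exact h j

/-- A gate reads two wires, so the number of relevant inputs at most doubles with each level. -/
theorem GateList.exists_dependsOn {ℓ s : ℕ} (L : GateList ℓ s) (j : Fin s) :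
    ∃ S : Finset (Fin ℓ), S.card ≤ 2 ^ L.depths j ∧
      DependsOn (fun x => L.values x j) (S : Set (Fin ℓ)) := by
  induction L with
  | nil => exact j.elim0
  | snoc L g ih =>
    induction j using Fin.lastCases with
    | cast j => simpa [GateList.depths, GateList.values] using ih j
    | last =>
      simp only [GateList.depths, GateList.values, Fin.snoc_last]
      cases g with
      | const b => exact ⟨∅, by simp, fun x y _ => rfl⟩
      | op φ u w =>
        obtain ⟨S, hS, hSd⟩ := Wire.exists_dependsOn (v := fun x => L.values x) ih u
        obtain ⟨S', hS', hSd'⟩ := Wire.exists_dependsOn (v := fun x => L.values x) ih w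
        refine ⟨S ∪ S', ?_, fun x y hxy => ?_⟩
        · refine (Finset.card_union_le _ _).trans ?_
          rw [BoolGate.depth, pow_succ, mul_two]
          exact add_le_add (hS.trans (Nat.pow_le_pow_right (by norm_num) (le_max_left _ _)))
            (hS'.trans (Nat.pow_le_pow_right (by norm_num) (le_max_right _ _)))
        · exact congrArg₂ φ (hSd fun i hi => hxy i (Finset.mem_union_left _ hi))
            (hSd' fun i hi => hxy i (Finset.mem_union_right _ hi))

theorem BoolCircuit.exists_dependsOn {ℓ n : ℕ} (K : BoolCircuit ℓ n) (i : Fin n) :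
    ∃ S : Finset (Fin ℓ), S.card ≤ 2 ^ K.depth ∧
      DependsOn (fun x => K.eval x i) (S : Set (Fin ℓ)) := by
  obtain ⟨S, hS, hSd⟩ := Wire.exists_dependsOn (v := fun x => K.gates.values x)
    K.gates.exists_dependsOn (K.out i)
  refine ⟨S, hS.trans (Nat.pow_le_pow_right (by norm_num) ?_), hSd⟩
  exact Finset.le_sup (f := fun i => (K.out i).depth K.gates.depths) (Finset.mem_univ i)

theorem BoolCircuit.outputDist_eq_valueDist {ℓ n : ℕ} (K : BoolCircuit ℓ n) :
    K.outputDist = valueDist fun i x => K.eval x i := by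
  funext y
  rw [BoolCircuit.outputDist, valueDist, cubeMean, Finset.sum_boole, Fintype.card_fin]

theorem two_mul_pow_le (d : ℕ) (hd : 0 < d) :
    2 * (10000 * d ^ 2 * 4 ^ d) ^ (2 * d) ≤ 2 ^ (37 * d ^ 2) := by
  have h1 : 10000 * d ^ 2 * 4 ^ d ≤ 2 ^ (18 * d) := by
    calc 10000 * d ^ 2 * 4 ^ d ≤ 2 ^ 14 * (2 ^ d) ^ 2 * (2 ^ 2) ^ d := by
          gcongr
          · norm_num
          · exact Nat.lt_two_pow_self.le
          · norm_num
      _ = 2 ^ (14 + 4 * d) := by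
          rw [← pow_mul, ← pow_mul, ← pow_add, ← pow_add]
          congr 1
          ring
      _ ≤ 2 ^ (18 * d) := Nat.pow_le_pow_right (by norm_num) (by omega)
  calc 2 * (10000 * d ^ 2 * 4 ^ d) ^ (2 * d) ≤ 2 * (2 ^ (18 * d)) ^ (2 * d) := by gcongr
    _ = 2 ^ (36 * d ^ 2 + 1) := by
        rw [← pow_mul, pow_succ]
        ring_nf
    _ ≤ 2 ^ (37 * d ^ 2) := Nat.pow_le_pow_right (by norm_num) (by nlinarith)

/-- Since 2 ≤ e, the bound on `t` gives (2^t)² ≤ √(log n); and 37·√(log n) ≤ log n because 1369 =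
37². -/
theorem two_pow_le_of_lt_log_log {n t : ℕ} (hn : 1369 ≤ Real.log n)
    (ht : (t : ℝ) < 1 / 4 * Real.log (Real.log n)) : 2 ^ (37 * (2 ^ t) ^ 2) ≤ n := by
  set L := Real.log n with hL
  have hL0 : 0 < L := by linarith
  have hn0 : (0 : ℝ) < n := by
    rcases Nat.eq_zero_or_pos n with h | h
    · rw [hL, h] at hn
      norm_num at hn
    · exact_mod_cast h
  have hd : ((2 : ℝ) ^ t) ^ 2 ≤ √L := by
    have h1 : (2 : ℝ) ≤ Real.exp 1 := by
      have := Real.add_one_le_exp (1 : ℝ)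
      linarith
    calc ((2 : ℝ) ^ t) ^ 2 ≤ (Real.exp 1 ^ t) ^ 2 := by gcongr
      _ = Real.exp (2 * t) := by
          rw [← pow_mul, ← Real.exp_nat_mul, mul_one]
          push_cast
          ring_nf
      _ ≤ Real.exp (Real.log L / 2) := Real.exp_le_exp.2 (by linarith)
      _ = √L := by rw [Real.exp_half, Real.exp_log hL0]
  have hs : 37 ≤ √L := Real.le_sqrt_of_sq_le (by linarith)
  have hsL : 37 * √L ≤ L := by
    nth_rewrite 2 [← Real.mul_self_sqrt hL0.le]
    exact mul_le_mul_of_nonneg_right hs (Real.sqrt_nonneg _)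
  have h2 : (2 : ℝ) ≤ Real.exp 1 := by
    have := Real.add_one_le_exp (1 : ℝ)
    linarith
  have h : (2 : ℝ) ^ (37 * (2 ^ t) ^ 2) ≤ n := by
    calc (2 : ℝ) ^ (37 * (2 ^ t) ^ 2) ≤ Real.exp 1 ^ (37 * (2 ^ t) ^ 2) :=
          pow_le_pow_left₀ (by norm_num) h2 _
      _ = Real.exp (37 * ((2 : ℝ) ^ t) ^ 2) := by
          rw [← Real.exp_nat_mul, mul_one]
          push_cast
          rfl
      _ ≤ Real.exp L := Real.exp_le_exp.2 (by linarith)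
      _ = n := Real.exp_log hn0
  exact_mod_cast h

/-- A shallow circuit of fan-in two does not sample biased bits, however many uniform bits it
takes. -/
theorem BoolCircuit.le_depth_of_tvDist_le {ℓ n : ℕ} (K : BoolCircuit ℓ n)
    (hn : 1369 ≤ Real.log n) (h : tvDist K.outputDist (coinCircuit n).outputDist ≤ 1 / 3) :
    1 / 4 * Real.log (Real.log n) ≤ K.depth := by
  by_contra! ht
  choose S hS hdep using K.exists_dependsOn
  have hlarge := (two_mul_pow_le _ (Nat.two_pow_pos K.depth)).trans
    (two_pow_le_of_lt_log_log hn ht)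
  have hlt := third_lt_tvDist_valueDist (fun i x => K.eval x i) S hdep hS
    (Nat.two_pow_pos _) (by rwa [Fintype.card_fin])
  rw [← K.outputDist_eq_valueDist, ← funext (coinCircuit_outputDist n)] at hlt
  linarith

theorem mainTheorem2 :
    ∃ C : (n : ℕ) → QuantumCircuit n,
      IsUniformFamily C ∧
      (∃ D : ℕ, ∀ n, (C n).depth ≤ D) ∧
      ∀ δ : ℝ, 0 ≤ δ → δ < 1 →
        ∃ c : ℝ, 0 < c ∧
          ∀ g : ℕ → ℝ, Tendsto (fun n : ℕ => g n * Real.log n) atTop atTop →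
            ∀ᶠ n : ℕ in atTop,
              ∀ ℓ : ℕ, ℓ ≤ n + ⌈(n : ℝ) ^ δ⌉₊ →
                ∀ K : BoolCircuit ℓ n,
                  tvDist K.outputDist (C n).outputDist ≤ 1 / 3 - g n →
                    c * Real.log (Real.log n) ≤ (K.depth : ℝ) := by
  refine ⟨coinCircuit, coinCircuit_isUniformFamily, ⟨1, fun n => le_rfl⟩, fun δ _ _ =>
    ⟨1 / 4, by norm_num, fun g hg => ?_⟩⟩
  -- For large `n` the slack `g n` is positive, which brings the distance below 1/3.
  filter_upwards [hg.eventually_gt_atTop 0,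
    (Real.tendsto_log_atTop.comp tendsto_natCast_atTop_atTop).eventually_ge_atTop 1369]
    with n hgn hn ℓ _ K hK
  have hlog : 1369 ≤ Real.log n := hn
  have hg0 : 0 < g n := pos_of_mul_pos_left hgn (by linarith)
  exact K.le_depth_of_tvDist_le hlog (by linarith)
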